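/- **Theorem (Higher Hilton–Rees).** Let $\Lambda$ be an artin algebra, i.e. an algebra that is finitely generated as a module over a commutative artinian ring, let $\mathrm{mod}\,\Lambda$ be the category of finitely generated $\Lambda$-modules, let $n\ge 1$, and let $\mathcal M$ be an $n$-cluster tilting subcategory of $\mathrm{mod}\,\Lambda$: a full additive subcategory, closed under isomorphisms, which is functorially finite (every module has a left and a right $\mathcal M$-approximation) and generating-cogenerating (every module is a quotient of an object of $\mathcal M$ and embeds in an object of $\mathcal M$), and which satisfies $$\mathcal M=\{A\mid \mathrm{Ext}^i_\Lambda(\mathcal M,A)=0 \text{ for } 0<i<n\}=\{A\mid \mathrm{Ext}^i_\Lambda(A,\mathcal M)=0\text{ for } 0<i<n\}.$$ For $X,Y\in\mathcal M$ let $\underline{\mathcal M}(X,Y)$ (respectively $\overline{\mathcal M}(X,Y)$) be the quotient of the group $\mathrm{Hom}_\Lambda(X,Y)$ by the subgroup of morphisms that factor through a projective (respectively injective) object of $\mathrm{mod}\,\Lambda$. Then for all $X,Y\in\mathcal M$: (i) there is an isomorphism of abelian groups between $\underline{\mathcal M}(X,Y)$ and the group of natural transformations from $\mathrm{Ext}^n_\Lambda(Y,-)|_{\mathcal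 M}$ to $\mathrm{Ext}^n_\Lambda(X,-)|_{\mathcal M}$, sending the class of $f\colon X\to Y$ to the transformation $\mathrm{Ext}^n_\Lambda(f,-)|_{\mathcal M}$; (ii) there is an isomorphism of abelian groups between $\overline{\mathcal M}(X,Y)$ and the group of natural transformations from $\mathrm{Ext}^n_\Lambda(-,X)|_{\mathcal M}$ to $\mathrm{Ext}^n_\Lambda(-,Y)|_{\mathcal M}$, sending the class of $f\colon X\to Y$ to the transformation $\mathrm{Ext}^n_\Lambda(-,f)|_{\mathcal M}$. -/

import Mathlib

open CategoryTheory CategoryTheory.Limits CategoryTheory.Abelian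
open scoped ZeroObject

universe w v u

/-- `Λ` is an artin algebra: an algebra over a commutative artinian ring `R` which is finitely
generated as an `R`-module. Taking `R` in the universe of `Λ` is no restriction, because `R` can
always be replaced by the centre of `Λ`, see `IsArtinAlgebra.of_algebra`. -/
class IsArtinAlgebra (Λ : Type u) [Ring Λ] : Prop where
  exists_base : ∃ (R : Type u) (_ : CommRing R) (_ : Algebra R Λ),
    IsArtinianRing R ∧ Module.Finite R Λ

theorem IsArtinAlgebra.of_algebra (R : Type w) [CommRing R] [IsArtinianRing R]
    (Λ : Type u) [Ring Λ] [Algebra R Λ] [Module.Finite R Λ] : IsArtinAlgebra Λ := by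
  have hart : IsArtinian R (Subalgebra.center R Λ) :=
    inferInstanceAs (IsArtinian R (Subalgebra.toSubmodule (Subalgebra.center R Λ)))
  have hart' : IsArtinianRing (Subalgebra.center R Λ) :=
    isArtinian_of_tower R hart
  let alg : Algebra (Subalgebra.center R Λ) Λ :=
    { algebraMap := (Subalgebra.center R Λ).val.toRingHom
      smul := fun c x => c • x
      commutes' := fun c x => ((Subalgebra.mem_center_iff.1 c.2) x).symm
      smul_def' := fun _ _ => rfl }
  exact ⟨Subalgebra.center R Λ, inferInstance, alg, hart',
    Module.Finite.of_restrictScalars_finite R _ Λ⟩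

instance IsArtinAlgebra.isNoetherianRing (Λ : Type u) [Ring Λ] [IsArtinAlgebra Λ] :
    IsNoetherianRing Λ := by
  obtain ⟨R, _, _, _, _⟩ := IsArtinAlgebra.exists_base (Λ := Λ)
  exact isNoetherian_of_tower R inferInstance

/-- Finitely generated modules over a noetherian ring have finitely generated free covers. -/
instance FGModuleCat.enoughProjectives_of_isNoetherianRing (Λ : Type u) [Ring Λ]
    [IsNoetherianRing Λ] : EnoughProjectives (FGModuleCat.{u} Λ) where
  presentation X := by
    obtain ⟨n, f, hf⟩ := Module.Finite.exists_fin' Λ X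
    have hproj : Projective (FGModuleCat.of Λ (Fin n → Λ)) := by
      refine ⟨fun {E Z} g e _ => ?_⟩
      have he : Epi ((forget₂ (FGModuleCat.{u} Λ) (ModuleCat.{u} Λ)).map e) := inferInstance
      obtain ⟨k, hk⟩ := Module.projective_lifting_property e.hom.hom g.hom.hom
        ((ModuleCat.epi_iff_surjective _).1 he)
      exact ⟨ObjectProperty.homMk (ModuleCat.ofHom k), FGModuleCat.hom_ext hk⟩
    let π : FGModuleCat.of Λ (Fin n → Λ) ⟶ X := ObjectProperty.homMk (ModuleCat.ofHom f)
    have hπ : Epi ((forget₂ (FGModuleCat.{u} Λ) (ModuleCat.{u} Λ)).map π) :=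
      (ModuleCat.epi_iff_surjective _).2 hf
    have : Epi π := Functor.epi_of_epi_map _ hπ
    exact ⟨⟨_, π⟩⟩

instance FGModuleCat.hasExt_of_isNoetherianRing (Λ : Type u) [Ring Λ] [IsNoetherianRing Λ] :
    HasExt.{u} (FGModuleCat.{u} Λ) :=
  hasExt_of_enoughProjectives.{u} (FGModuleCat.{u} Λ)

section ClusterTilting

variable {C : Type u} [Category.{v} C]

/-- `π : B ⟶ A` is a right `M`-approximation of `A`: `B` lies in `M`, and every morphism from an
object of `M` to `A` factors through `π`. -/
def IsRightApproximation (M : ObjectProperty C) {B A : C} (π : B ⟶ A) : Prop :=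
  M B ∧ ∀ (N : C), M N → ∀ f : N ⟶ A, ∃ g : N ⟶ B, g ≫ π = f

/-- `ι : A ⟶ B` is a left `M`-approximation of `A`: `B` lies in `M`, and every morphism from `A`
to an object of `M` factors through `ι`. -/
def IsLeftApproximation (M : ObjectProperty C) {A B : C} (ι : A ⟶ B) : Prop :=
  M B ∧ ∀ (N : C), M N → ∀ f : A ⟶ N, ∃ g : B ⟶ N, ι ≫ g = f

/-- Every object has a right `M`-approximation and a left `M`-approximation. -/
structure IsFunctoriallyFinite (M : ObjectProperty C) : Prop where
  contravariantly_finite : ∀ A : C, ∃ (B : C) (π : B ⟶ A), IsRightApproximation M π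
  covariantly_finite : ∀ A : C, ∃ (B : C) (ι : A ⟶ B), IsLeftApproximation M ι

/-- Every object is a quotient and a subobject of objects of `M`. -/
structure IsGeneratingCogenerating (M : ObjectProperty C) : Prop where
  generating : ∀ A : C, ∃ (B : C) (π : B ⟶ A), M B ∧ Epi π
  cogenerating : ∀ A : C, ∃ (B : C) (ι : A ⟶ B), M B ∧ Mono ι

variable [Abelian C]

/-- The objects `A` with `Ext^i(N, A) = 0` for all `N` in `M` and `0 < i < n`. -/
def rightExtPerp [HasExt.{w} C] (M : ObjectProperty C) (n : ℕ) : ObjectProperty C :=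
  fun A => ∀ N : C, M N → ∀ i : ℕ, 0 < i → i < n → Subsingleton (Ext.{w} N A i)

/-- The objects `A` with `Ext^i(A, N) = 0` for all `N` in `M` and `0 < i < n`. -/
def leftExtPerp [HasExt.{w} C] (M : ObjectProperty C) (n : ℕ) : ObjectProperty C :=
  fun A => ∀ N : C, M N → ∀ i : ℕ, 0 < i → i < n → Subsingleton (Ext.{w} A N i)

/-- The full subcategory on the objects satisfying `M` is an `n`-cluster tilting subcategory of
the abelian category `C`. -/
structure IsClusterTilting [HasExt.{w} C] (M : ObjectProperty C) (n : ℕ) : Prop where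
  zero_mem : M.ContainsZero
  iso_mem : M.IsClosedUnderIsomorphisms
  biprod_mem : ∀ A B : C, M A → M B → M (A ⊞ B)
  functoriallyFinite : IsFunctoriallyFinite M
  generatingCogenerating : IsGeneratingCogenerating M
  rightExtPerp_eq : rightExtPerp.{w} M n = M
  leftExtPerp_eq : leftExtPerp.{w} M n = M

/-- The morphisms `X ⟶ Y` that factor through a projective object. -/
def projectiveHoms (X Y : C) : AddSubgroup (X ⟶ Y) where
  carrier := {f | ∃ (P : C) (_ : Projective P) (g : X ⟶ P) (h : P ⟶ Y), g ≫ h = f}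
  zero_mem' := ⟨(0 : C), inferInstance, 0, 0, by simp⟩
  add_mem' := by
    rintro _ _ ⟨P, _, g, h, rfl⟩ ⟨P', _, g', h', rfl⟩
    exact ⟨P ⊞ P', inferInstance, biprod.lift g g', biprod.desc h h', by simp⟩
  neg_mem' := by
    rintro _ ⟨P, hP, g, h, rfl⟩
    exact ⟨P, hP, g, -h, by simp⟩

/-- The morphisms `X ⟶ Y` that factor through an injective object. -/
def injectiveHoms (X Y : C) : AddSubgroup (X ⟶ Y) where
  carrier := {f | ∃ (I : C) (_ : Injective I) (g : X ⟶ I) (h : I ⟶ Y), g ≫ h = f}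
  zero_mem' := ⟨(0 : C), inferInstance, 0, 0, by simp⟩
  add_mem' := by
    rintro _ _ ⟨P, _, g, h, rfl⟩ ⟨P', _, g', h', rfl⟩
    exact ⟨P ⊞ P', inferInstance, biprod.lift g g', biprod.desc h h', by simp⟩
  neg_mem' := by
    rintro _ ⟨P, hP, g, h, rfl⟩
    exact ⟨P, hP, g, -h, by simp⟩

/-- Morphisms modulo those factoring through a projective object. An `n`-cluster tilting
subcategory contains all projective objects, so for `X`, `Y` in such a subcategory this is the
group of morphisms `X ⟶ Y` in its stable category. -/
abbrev StableHom (X Y : C) : Type v := (X ⟶ Y) ⧸ projectiveHoms X Y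

/-- Morphisms modulo those factoring through an injective object. An `n`-cluster tilting
subcategory contains all injective objects, so for `X`, `Y` in such a subcategory this is the
group of morphisms `X ⟶ Y` in its costable category. -/
abbrev CostableHom (X Y : C) : Type v := (X ⟶ Y) ⧸ injectiveHoms X Y

/-- The functor `Ext^n(X, -)` restricted to the full subcategory `M`. -/
noncomputable abbrev covariantExtOn [HasExt.{w} C] (M : ObjectProperty C) (n : ℕ) (X : C) :
    M.FullSubcategory ⥤ AddCommGrpCat.{w} :=
  M.ι ⋙ (extFunctor.{w} n).obj (Opposite.op X)

/-- The functor `Ext^n(-, X)` restricted to the full subcategory `M`. -/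
noncomputable abbrev contravariantExtOn [HasExt.{w} C] (M : ObjectProperty C) (n : ℕ) (X : C) :
    M.FullSubcategoryᵒᵖ ⥤ AddCommGrpCat.{w} :=
  M.ι.op ⋙ (extFunctor.{w} n).flip.obj X

/-- The transformation `Ext^n(Y, -) ⟶ Ext^n(X, -)` on `M` induced by `f : X ⟶ Y`. -/
noncomputable abbrev covariantExtOnMap [HasExt.{w} C] (M : ObjectProperty C) (n : ℕ) {X Y : C}
    (f : X ⟶ Y) : covariantExtOn.{w} M n Y ⟶ covariantExtOn.{w} M n X :=
  Functor.whiskerLeft M.ι ((extFunctor.{w} n).map f.op)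

/-- The transformation `Ext^n(-, X) ⟶ Ext^n(-, Y)` on `M` induced by `f : X ⟶ Y`. -/
noncomputable abbrev contravariantExtOnMap [HasExt.{w} C] (M : ObjectProperty C) (n : ℕ) {X Y : C}
    (f : X ⟶ Y) : contravariantExtOn.{w} M n X ⟶ contravariantExtOn.{w} M n Y :=
  Functor.whiskerLeft M.ι.op ((extFunctor.{w} n).flip.map f)

end ClusterTilting

/-! The proof of (i) is a Yoneda argument with a generator in degree `n`. Resolve `Y` by an
epimorphism from a projective `P`, then take right `M`-approximations of the successive kernels.
After `n` steps this gives an exact sequence ending in a kernel `K` and its class `cls` in `Ext^n(Y,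
K)`. The approximations and the vanishing of `Ext^i` within `M` make `K` right orthogonal to `M`,
hence `K` lies in `M` and a transformation `φ` can be evaluated at `cls`.

Dimension shifting gives three facts (`SyzygyClass`): every class in `Ext^n(Y, A)` with `A` in `M`
is a pushout of `cls`, so `φ` is determined by `φ(cls)`; classes in `Ext^n(X, K)` killed by `m : K ⟶
N`, as `φ(cls)` is by naturality, are pullbacks of `cls` along some `f : X ⟶ Y`; and such a pullback
vanishes only if `f` factors through a projective. Part (ii) is dual (`CosyzygyClass`).

The dual needs an embedding of `X` into an injective of `mod Λ`. Essential extensions of `X` have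
bounded length over an artin algebra (`IsArtinAlgebra.exists_length_bound`), and one of maximal
length is injective. -/

section HigherHiltonRees

variable {C : Type u} [Category.{v} C] [Abelian C]

/-! ### Exact sequences, Ext vanishing and first properties of `M`. -/

lemma shortExact_kernel_of_epi {A B : C} (π : A ⟶ B) [Epi π] :
    (ShortComplex.mk (kernel.ι π) π (kernel.condition π)).ShortExact where
  exact := ShortComplex.exact_of_f_is_kernel _ (kernelIsKernel π)

lemma shortExact_cokernel_of_mono {A B : C} (ι : A ⟶ B) [Mono ι] :
    (ShortComplex.mk ι (cokernel.π ι) (cokernel.condition ι)).ShortExact where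
  exact := ShortComplex.exact_of_g_is_cokernel _ (cokernelIsCokernel ι)

variable [HasExt.{w} C]

lemma ext_subsingleton_of_projective {P : C} [Projective P] (A : C) {i : ℕ} (hi : 0 < i) :
    Subsingleton (Ext.{w} P A i) := by
  obtain ⟨j, rfl⟩ := Nat.exists_eq_succ_of_ne_zero hi.ne'
  exact Ext.subsingleton_of_projective P A j

lemma ext_subsingleton_of_injective {I : C} [Injective I] (A : C) {i : ℕ} (hi : 0 < i) :
    Subsingleton (Ext.{w} A I i) := by
  obtain ⟨j, rfl⟩ := Nat.exists_eq_succ_of_ne_zero hi.ne'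
  exact Ext.subsingleton_of_injective A I j

namespace IsClusterTilting

variable {M : ObjectProperty C} {n : ℕ}

lemma ext_subsingleton (hM : IsClusterTilting.{w} M n) {A B : C} (hA : M A) (hB : M B) {i : ℕ}
    (hi : 0 < i) (hin : i < n) : Subsingleton (Ext.{w} A B i) := by
  rw [← hM.rightExtPerp_eq] at hB
  exact hB A hA i hi hin

lemma mem_of_projective (hM : IsClusterTilting.{w} M n) (P : C) [Projective P] : M P := by
  rw [← hM.leftExtPerp_eq]
  exact fun N _ i hi _ => ext_subsingleton_of_projective N hi

lemma mem_of_injective (hM : IsClusterTilting.{w} M n) (I : C) [Injective I] : M I := by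
  rw [← hM.rightExtPerp_eq]
  exact fun N _ i hi _ => ext_subsingleton_of_injective N hi

lemma epi_of_isRightApproximation (hM : IsClusterTilting.{w} M n) {A B : C} {π : B ⟶ A}
    (h : IsRightApproximation M π) : Epi π := by
  obtain ⟨N, p, hN, hp⟩ := hM.generatingCogenerating.generating A
  obtain ⟨g, rfl⟩ := h.2 N hN p
  exact epi_of_epi g π

lemma mono_of_isLeftApproximation (hM : IsClusterTilting.{w} M n) {A B : C} {ι : A ⟶ B}
    (h : IsLeftApproximation M ι) : Mono ι := by
  obtain ⟨N, p, hN, hp⟩ := hM.generatingCogenerating.cogenerating A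
  obtain ⟨g, rfl⟩ := h.2 N hN p
  exact mono_of_mono ι g

end IsClusterTilting

/-- The end of an exact sequence `0 ⟶ K ⟶ N ⟶ ⋯ ⟶ P ⟶ Y ⟶ 0` with `P` projective and the
remaining middle terms given by right `M`-approximations, together with its Yoneda class. -/
structure SyzygyClass (M : ObjectProperty C) (n : ℕ) (Y : C) (k : ℕ) where
  K : C
  N : C
  mem_N : M N
  m : K ⟶ N
  cls : Ext.{w} Y K k
  cls_comp : cls.comp (Ext.mk₀ m) (add_zero k) = 0
  perp : ∀ A : C, M A → ∀ i : ℕ, 0 < i → i < k → Subsingleton (Ext.{w} A K i)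
  faithful : ∀ A : C, M A → ∀ f : A ⟶ Y, (Ext.mk₀ f).comp cls (zero_add k) = 0 →
    f ∈ projectiveHoms A Y
  full : ∀ A : C, M A → ∀ η : Ext.{w} A K k, η.comp (Ext.mk₀ m) (add_zero k) = 0 →
    ∃ f : A ⟶ Y, (Ext.mk₀ f).comp cls (zero_add k) = η
  generates : ∀ A : C, M A → ∀ ζ : Ext.{w} Y A n, ∀ (j : ℕ) (hj : k + j = n),
    ∃ θ : Ext.{w} K A j, cls.comp θ hj = ζ

/-- The end of an exact sequence `0 ⟶ X ⟶ I ⟶ ⋯ ⟶ N ⟶ K ⟶ 0` with `I` injective and the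
remaining middle terms given by left `M`-approximations, together with its Yoneda class. -/
structure CosyzygyClass (M : ObjectProperty C) (n : ℕ) (X : C) (k : ℕ) where
  K : C
  N : C
  mem_N : M N
  m : N ⟶ K
  cls : Ext.{w} K X k
  comp_cls : (Ext.mk₀ m).comp cls (zero_add k) = 0
  perp : ∀ A : C, M A → ∀ i : ℕ, 0 < i → i < k → Subsingleton (Ext.{w} K A i)
  faithful : ∀ A : C, M A → ∀ f : X ⟶ A, cls.comp (Ext.mk₀ f) (add_zero k) = 0 →
    f ∈ injectiveHoms X A
  full : ∀ A : C, M A → ∀ η : Ext.{w} K A k, (Ext.mk₀ m).comp η (zero_add k) = 0 →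
    ∃ f : X ⟶ A, cls.comp (Ext.mk₀ f) (add_zero k) = η
  generates : ∀ A : C, M A → ∀ ζ : Ext.{w} A X n, ∀ (j : ℕ) (hj : j + k = n),
    ∃ θ : Ext.{w} A K j, θ.comp cls hj = ζ

/-! ### Construction of the syzygy and cosyzygy classes. -/

namespace IsClusterTilting

variable {M : ObjectProperty C} {n : ℕ}

/-- Projectivity of `P` enters here: `f` with zero pullback lifts to `P`, and `Ext^n(P, A) = 0`
gives `generates`. -/
lemma nonempty_syzygyClass_one (hM : IsClusterTilting.{w} M n) (hn : 1 ≤ n) {P Y : C}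
    [Projective P] (π : P ⟶ Y) [Epi π] : Nonempty (SyzygyClass.{w} M n Y 1) := by
  have hS := shortExact_kernel_of_epi π
  refine ⟨⟨kernel π, P, hM.mem_of_projective P, kernel.ι π, hS.extClass, hS.extClass_comp,
    fun _ _ i hi hi' => by omega, fun A hA f hf => ?_, fun A hA η hη => ?_,
    fun A hA ζ j hj => ?_⟩⟩
  · obtain ⟨x, hx⟩ := Ext.covariant_sequence_exact₃ A hS (Ext.mk₀ f) _ hf
    obtain ⟨g, rfl⟩ := (Ext.mk₀_bijective _ _).2 x
    rw [Ext.mk₀_comp_mk₀] at hx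
    exact ⟨P, inferInstance, g, π, (Ext.mk₀_bijective _ _).1 hx⟩
  · obtain ⟨x, hx⟩ := Ext.covariant_sequence_exact₁ A hS η hη (zero_add 1)
    obtain ⟨f, rfl⟩ := (Ext.mk₀_bijective _ _).2 x
    exact ⟨f, hx⟩
  · have := ext_subsingleton_of_projective.{w} (P := P) A (by omega : 0 < n)
    exact Ext.contravariant_sequence_exact₃ hS A ζ (Subsingleton.elim _ _) hj

/-- The sequence `0 ⟶ kernel π ⟶ N ⟶ D.K ⟶ 0` is spliced onto `D`. As `0 < k < n`, the groups
`Ext^k(A, N)` and `Ext^k(A, D.N)` vanish: the first makes composition with the new connecting class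
injective, the second makes the side condition of `D.full` automatic. -/
lemma nonempty_syzygyClass_succ (hM : IsClusterTilting.{w} M n) {Y : C} {k : ℕ}
    (hk : 1 ≤ k) (hkn : k + 1 ≤ n) (D : SyzygyClass.{w} M n Y k) :
    Nonempty (SyzygyClass.{w} M n Y (k + 1)) := by
  obtain ⟨N, π, hπ⟩ := hM.functoriallyFinite.contravariantly_finite D.K
  have := hM.epi_of_isRightApproximation hπ
  have hS := shortExact_kernel_of_epi π
  refine ⟨⟨kernel π, N, hπ.1, kernel.ι π, D.cls.comp hS.extClass rfl, ?_, fun A hA i hi hi' => ?_,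
    fun A hA f hf => ?_, fun A hA η hη => ?_, fun A hA ζ j hj => ?_⟩⟩
  · rw [Ext.comp_assoc_of_third_deg_zero, hS.extClass_comp, Ext.comp_zero]
  · have hN := hM.ext_subsingleton hA hπ.1 hi (by omega)
    refine subsingleton_of_forall_eq 0 fun x => ?_
    obtain ⟨j, rfl⟩ := Nat.exists_eq_succ_of_ne_zero hi.ne'
    obtain ⟨y, rfl⟩ := Ext.covariant_sequence_exact₁ A hS x (Subsingleton.elim _ _) rfl
    -- In degree `i = 1` orthogonality comes from the approximation property: each `A ⟶ D.K` lifts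
    -- to `N`, so the connecting map kills it. Higher degrees shift down to `D.perp`.
    rcases Nat.eq_zero_or_pos j with rfl | hj
    · obtain ⟨f, rfl⟩ := (Ext.mk₀_bijective _ _).2 y
      obtain ⟨g, rfl⟩ := hπ.2 A hA f
      rw [← Ext.mk₀_comp_mk₀, Ext.comp_assoc_of_second_deg_zero, hS.comp_extClass, Ext.comp_zero]
    · have := D.perp A hA j hj (by omega)
      rw [Subsingleton.elim y 0, Ext.zero_comp]
  · have hN := hM.ext_subsingleton hA hπ.1 hk (by omega)
    refine D.faithful A hA f ?_
    rw [← Ext.comp_assoc _ _ _ (zero_add k) rfl (by omega)] at hf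
    obtain ⟨y, hy⟩ := Ext.covariant_sequence_exact₃ A hS _ rfl hf
    rw [← hy, Subsingleton.elim y 0, Ext.zero_comp]
  · have hN := hM.ext_subsingleton hA D.mem_N hk (by omega)
    obtain ⟨y, rfl⟩ := Ext.covariant_sequence_exact₁ A hS η hη rfl
    obtain ⟨f, rfl⟩ := D.full A hA y (Subsingleton.elim _ _)
    exact ⟨f, (Ext.comp_assoc _ _ _ (zero_add k) rfl (by omega)).symm⟩
  · obtain ⟨θ, rfl⟩ := D.generates A hA ζ (1 + j) (by omega)
    -- `1 + j < n` because `k + (1 + j) = n` and `k ≥ 1`.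
    have hN := hM.ext_subsingleton hπ.1 hA (by omega : 0 < 1 + j) (by omega)
    obtain ⟨θ', rfl⟩ := Ext.contravariant_sequence_exact₃ hS A θ (Subsingleton.elim _ _) rfl
    exact ⟨θ', Ext.comp_assoc _ _ _ rfl rfl (by omega)⟩

lemma nonempty_cosyzygyClass_one (hM : IsClusterTilting.{w} M n) (hn : 1 ≤ n) {I X : C}
    [Injective I] (ι : X ⟶ I) [Mono ι] : Nonempty (CosyzygyClass.{w} M n X 1) := by
  have hS := shortExact_cokernel_of_mono ι
  refine ⟨⟨cokernel ι, I, hM.mem_of_injective I, cokernel.π ι, hS.extClass, hS.comp_extClass,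
    fun _ _ i hi hi' => by omega, fun A hA f hf => ?_, fun A hA η hη => ?_,
    fun A hA ζ j hj => ?_⟩⟩
  · obtain ⟨x, hx⟩ := Ext.contravariant_sequence_exact₁ hS A (Ext.mk₀ f) _ hf
    obtain ⟨g, rfl⟩ := (Ext.mk₀_bijective _ _).2 x
    rw [Ext.mk₀_comp_mk₀] at hx
    exact ⟨I, inferInstance, ι, g, (Ext.mk₀_bijective _ _).1 hx⟩
  · obtain ⟨x, hx⟩ := Ext.contravariant_sequence_exact₃ hS A η hη (add_zero 1)
    obtain ⟨f, rfl⟩ := (Ext.mk₀_bijective _ _).2 x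
    exact ⟨f, hx⟩
  · have := ext_subsingleton_of_injective.{w} (I := I) A (by omega : 0 < n)
    exact Ext.covariant_sequence_exact₁ A hS ζ (Subsingleton.elim _ _) hj

/-- Dual splice: left approximations give the vanishing of `Ext^1(cokernel ι, A)`. -/
lemma nonempty_cosyzygyClass_succ (hM : IsClusterTilting.{w} M n) {X : C} {k : ℕ}
    (hk : 1 ≤ k) (hkn : k + 1 ≤ n) (D : CosyzygyClass.{w} M n X k) :
    Nonempty (CosyzygyClass.{w} M n X (k + 1)) := by
  obtain ⟨N, ι, hι⟩ := hM.functoriallyFinite.covariantly_finite D.K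
  have := hM.mono_of_isLeftApproximation hι
  have hS := shortExact_cokernel_of_mono ι
  refine ⟨⟨cokernel ι, N, hι.1, cokernel.π ι, hS.extClass.comp D.cls (add_comm 1 k), ?_,
    fun A hA i hi hi' => ?_, fun A hA f hf => ?_, fun A hA η hη => ?_, fun A hA ζ j hj => ?_⟩⟩
  · exact hS.comp_extClass_assoc _ _
  · have hN := hM.ext_subsingleton hι.1 hA hi (by omega)
    refine subsingleton_of_forall_eq 0 fun x => ?_
    obtain ⟨j, rfl⟩ : ∃ j, i = 1 + j := ⟨i - 1, by omega⟩
    obtain ⟨y, rfl⟩ := Ext.contravariant_sequence_exact₃ hS A x (Subsingleton.elim _ _) rfl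
    rcases Nat.eq_zero_or_pos j with rfl | hj
    · obtain ⟨f, rfl⟩ := (Ext.mk₀_bijective _ _).2 y
      obtain ⟨g, rfl⟩ := hι.2 A hA f
      rw [← Ext.mk₀_comp_mk₀]
      exact hS.extClass_comp_assoc _
    · have := D.perp A hA j hj (by omega)
      rw [Subsingleton.elim y 0, Ext.comp_zero]
  · have hN := hM.ext_subsingleton hι.1 hA hk (by omega)
    refine D.faithful A hA f ?_
    rw [Ext.comp_assoc_of_third_deg_zero] at hf
    obtain ⟨y, hy⟩ := Ext.contravariant_sequence_exact₁ hS A _ (add_comm 1 k) hf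
    rw [← hy, Subsingleton.elim y 0, Ext.comp_zero]
  · have hN := hM.ext_subsingleton D.mem_N hA hk (by omega)
    obtain ⟨y, rfl⟩ := Ext.contravariant_sequence_exact₃ hS A η hη (add_comm 1 k)
    obtain ⟨f, rfl⟩ := D.full A hA y (Subsingleton.elim _ _)
    exact ⟨f, Ext.comp_assoc_of_third_deg_zero _ _ _ _⟩
  · obtain ⟨θ, rfl⟩ := D.generates A hA ζ (j + 1) (by omega)
    have hN := hM.ext_subsingleton hA hι.1 (by omega : 0 < j + 1) (by omega)
    obtain ⟨θ', rfl⟩ := Ext.covariant_sequence_exact₁ A hS θ (Subsingleton.elim _ _) rfl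
    exact ⟨θ', (Ext.comp_assoc _ _ _ rfl (add_comm 1 k) (by omega)).symm⟩

lemma nonempty_syzygyClass (hM : IsClusterTilting.{w} M n) {P Y : C} [Projective P] (π : P ⟶ Y)
    [Epi π] {k : ℕ} (hk : 1 ≤ k) (hkn : k ≤ n) : Nonempty (SyzygyClass.{w} M n Y k) := by
  induction k, hk using Nat.le_induction with
  | base => exact hM.nonempty_syzygyClass_one hkn π
  | succ k hk ih =>
    obtain ⟨D⟩ := ih (by omega)
    exact hM.nonempty_syzygyClass_succ hk hkn D

lemma nonempty_cosyzygyClass (hM : IsClusterTilting.{w} M n) {I X : C} [Injective I] (ι : X ⟶ I)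
    [Mono ι] {k : ℕ} (hk : 1 ≤ k) (hkn : k ≤ n) : Nonempty (CosyzygyClass.{w} M n X k) := by
  induction k, hk using Nat.le_induction with
  | base => exact hM.nonempty_cosyzygyClass_one hkn ι
  | succ k hk ih =>
    obtain ⟨D⟩ := ih (by omega)
    exact hM.nonempty_cosyzygyClass_succ hk hkn D

/-! ### Natural transformations of Ext functors and the Yoneda argument. -/

/-- The component at `A` of a transformation `Ext^n(Y, -) ⟶ Ext^n(X, -)` on `M`. -/
noncomputable def covariantApp {X Y : C} (φ : covariantExtOn.{w} M n Y ⟶ covariantExtOn.{w} M n X)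
    {A : C} (hA : M A) : Ext.{w} Y A n →+ Ext.{w} X A n :=
  (φ.app ⟨A, hA⟩).hom

lemma covariantApp_ext {X Y : C} {φ ψ : covariantExtOn.{w} M n Y ⟶ covariantExtOn.{w} M n X}
    (h : ∀ (A : C) (hA : M A) (x : Ext.{w} Y A n), covariantApp φ hA x = covariantApp ψ hA x) :
    φ = ψ := by
  ext A x
  exact h A.obj A.property x

lemma covariantApp_map {X Y : C} (f : X ⟶ Y) {A : C} (hA : M A) (x : Ext.{w} Y A n) :
    covariantApp (covariantExtOnMap.{w} M n f) hA x = (Ext.mk₀ f).comp x (zero_add n) :=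
  rfl

lemma covariantApp_zero {X Y : C} {A : C} (hA : M A) (x : Ext.{w} Y A n) :
    covariantApp (0 : covariantExtOn.{w} M n Y ⟶ covariantExtOn.{w} M n X) hA x = 0 :=
  rfl

lemma covariantApp_add {X Y : C} (φ ψ : covariantExtOn.{w} M n Y ⟶ covariantExtOn.{w} M n X)
    {A : C} (hA : M A) (x : Ext.{w} Y A n) :
    covariantApp (φ + ψ) hA x = covariantApp φ hA x + covariantApp ψ hA x :=
  rfl

lemma covariantApp_comp {X Y : C} (φ : covariantExtOn.{w} M n Y ⟶ covariantExtOn.{w} M n X)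
    {A B : C} (hA : M A) (hB : M B) (x : Ext.{w} Y A n) (g : A ⟶ B) :
    covariantApp φ hB (x.comp (Ext.mk₀ g) (add_zero n)) =
      (covariantApp φ hA x).comp (Ext.mk₀ g) (add_zero n) :=
  DFunLike.congr_fun (congrArg AddCommGrpCat.Hom.hom
    (φ.naturality (X := ⟨A, hA⟩) (Y := ⟨B, hB⟩) (ObjectProperty.homMk g))) x

/-- The component at `A` of a transformation `Ext^n(-, X) ⟶ Ext^n(-, Y)` on `M`. -/
noncomputable def contravariantApp {X Y : C}
    (φ : contravariantExtOn.{w} M n X ⟶ contravariantExtOn.{w} M n Y)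
    {A : C} (hA : M A) : Ext.{w} A X n →+ Ext.{w} A Y n :=
  (φ.app (Opposite.op ⟨A, hA⟩)).hom

lemma contravariantApp_ext {X Y : C}
    {φ ψ : contravariantExtOn.{w} M n X ⟶ contravariantExtOn.{w} M n Y}
    (h : ∀ (A : C) (hA : M A) (x : Ext.{w} A X n),
      contravariantApp φ hA x = contravariantApp ψ hA x) : φ = ψ := by
  ext A x
  exact h A.unop.obj A.unop.property x

lemma contravariantApp_map {X Y : C} (f : X ⟶ Y) {A : C} (hA : M A) (x : Ext.{w} A X n) :
    contravariantApp (contravariantExtOnMap.{w} M n f) hA x = x.comp (Ext.mk₀ f) (add_zero n) :=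
  rfl

lemma contravariantApp_zero {X Y : C} {A : C} (hA : M A) (x : Ext.{w} A X n) :
    contravariantApp (0 : contravariantExtOn.{w} M n X ⟶ contravariantExtOn.{w} M n Y) hA x = 0 :=
  rfl

lemma contravariantApp_add {X Y : C}
    (φ ψ : contravariantExtOn.{w} M n X ⟶ contravariantExtOn.{w} M n Y)
    {A : C} (hA : M A) (x : Ext.{w} A X n) :
    contravariantApp (φ + ψ) hA x = contravariantApp φ hA x + contravariantApp ψ hA x :=
  rfl

lemma contravariantApp_comp {X Y : C}
    (φ : contravariantExtOn.{w} M n X ⟶ contravariantExtOn.{w} M n Y)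
    {A B : C} (hA : M A) (hB : M B) (x : Ext.{w} A X n) (g : B ⟶ A) :
    contravariantApp φ hB ((Ext.mk₀ g).comp x (zero_add n)) =
      (Ext.mk₀ g).comp (contravariantApp φ hA x) (zero_add n) :=
  DFunLike.congr_fun (congrArg AddCommGrpCat.Hom.hom
    (φ.naturality (X := Opposite.op ⟨A, hA⟩) (Y := Opposite.op ⟨B, hB⟩)
      (Quiver.Hom.op (V := M.FullSubcategory) (X := ⟨B, hB⟩) (Y := ⟨A, hA⟩)
        (ObjectProperty.homMk g)))) x

lemma covariantExtOnMap_eq_zero (hn : 1 ≤ n) {X Y : C} {f : X ⟶ Y} (hf : f ∈ projectiveHoms X Y) :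
    covariantExtOnMap.{w} M n f = 0 := by
  obtain ⟨P, _, g, h, rfl⟩ := hf
  refine covariantApp_ext fun A hA x => ?_
  have := ext_subsingleton_of_projective.{w} (P := P) A hn
  rw [covariantApp_map, covariantApp_zero, ← Ext.mk₀_comp_mk₀_assoc,
    Subsingleton.elim ((Ext.mk₀ h).comp x (zero_add n)) 0, Ext.comp_zero]

lemma contravariantExtOnMap_eq_zero (hn : 1 ≤ n) {X Y : C} {f : X ⟶ Y}
    (hf : f ∈ injectiveHoms X Y) : contravariantExtOnMap.{w} M n f = 0 := by
  obtain ⟨I, _, g, h, rfl⟩ := hf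
  refine contravariantApp_ext fun A hA x => ?_
  have := ext_subsingleton_of_injective.{w} (I := I) A hn
  rw [contravariantApp_map, contravariantApp_zero, ← Ext.mk₀_comp_mk₀,
    ← Ext.comp_assoc_of_third_deg_zero,
    Subsingleton.elim (x.comp (Ext.mk₀ g) (add_zero n)) 0, Ext.zero_comp]

lemma covariantExtOnMap_add {X Y : C} (f g : X ⟶ Y) :
    covariantExtOnMap.{w} M n (f + g) = covariantExtOnMap.{w} M n f + covariantExtOnMap.{w} M n g :=
  covariantApp_ext fun A hA x => by
    rw [covariantApp_add, covariantApp_map, covariantApp_map, covariantApp_map, Ext.mk₀_add,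
      Ext.add_comp]

lemma contravariantExtOnMap_add {X Y : C} (f g : X ⟶ Y) :
    contravariantExtOnMap.{w} M n (f + g) =
      contravariantExtOnMap.{w} M n f + contravariantExtOnMap.{w} M n g :=
  contravariantApp_ext fun A hA x => by
    rw [contravariantApp_add, contravariantApp_map, contravariantApp_map, contravariantApp_map,
      Ext.mk₀_add, Ext.comp_add]

lemma mem_projectiveHoms_of_covariantExtOnMap_eq_zero (hM : IsClusterTilting.{w} M n) {X Y : C}
    (hX : M X) (D : SyzygyClass.{w} M n Y n) {f : X ⟶ Y} (hf : covariantExtOnMap.{w} M n f = 0) :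
    f ∈ projectiveHoms X Y := by
  -- At level `k = n`, `perp` is exactly the orthogonality that characterises `M`.
  have hK : M D.K := hM.rightExtPerp_eq.le _ D.perp
  refine D.faithful X hX f ?_
  rw [← covariantApp_map f hK, hf, covariantApp_zero]

lemma mem_injectiveHoms_of_contravariantExtOnMap_eq_zero (hM : IsClusterTilting.{w} M n) {X Y : C}
    (hY : M Y) (D : CosyzygyClass.{w} M n X n) {f : X ⟶ Y}
    (hf : contravariantExtOnMap.{w} M n f = 0) : f ∈ injectiveHoms X Y := by
  have hK : M D.K := hM.leftExtPerp_eq.le _ D.perp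
  refine D.faithful Y hY f ?_
  rw [← contravariantApp_map f hK, hf, contravariantApp_zero]

lemma exists_covariantExtOnMap_eq (hM : IsClusterTilting.{w} M n) {X Y : C}
    (hX : M X) (D : SyzygyClass.{w} M n Y n)
    (φ : covariantExtOn.{w} M n Y ⟶ covariantExtOn.{w} M n X) :
    ∃ f : X ⟶ Y, covariantExtOnMap.{w} M n f = φ := by
  have hK : M D.K := hM.rightExtPerp_eq.le _ D.perp
  obtain ⟨f, hf⟩ := D.full X hX (covariantApp φ hK D.cls) <| by
    rw [← covariantApp_comp φ hK D.mem_N, D.cls_comp, map_zero]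
  refine ⟨f, covariantApp_ext fun A hA x => ?_⟩
  -- With `j = 0` the factor `θ` is a morphism `K ⟶ A`, so naturality of `φ` applies.
  obtain ⟨y, rfl⟩ := D.generates A hA x 0 (add_zero n)
  obtain ⟨θ, rfl⟩ := (Ext.mk₀_bijective _ _).2 y
  rw [covariantApp_comp φ hK hA, ← hf, covariantApp_map, Ext.comp_assoc_of_third_deg_zero]

lemma exists_contravariantExtOnMap_eq (hM : IsClusterTilting.{w} M n) {X Y : C}
    (hY : M Y) (D : CosyzygyClass.{w} M n X n)
    (φ : contravariantExtOn.{w} M n X ⟶ contravariantExtOn.{w} M n Y) :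
    ∃ f : X ⟶ Y, contravariantExtOnMap.{w} M n f = φ := by
  have hK : M D.K := hM.leftExtPerp_eq.le _ D.perp
  obtain ⟨f, hf⟩ := D.full Y hY (contravariantApp φ hK D.cls) <| by
    rw [← contravariantApp_comp φ hK D.mem_N, D.comp_cls, map_zero]
  refine ⟨f, contravariantApp_ext fun A hA x => ?_⟩
  obtain ⟨y, rfl⟩ := D.generates A hA x 0 (zero_add n)
  obtain ⟨θ, rfl⟩ := (Ext.mk₀_bijective _ _).2 y
  rw [contravariantApp_comp φ hK hA, ← hf, contravariantApp_map, Ext.comp_assoc_of_third_deg_zero]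

theorem exists_stableHom_addEquiv (hM : IsClusterTilting.{w} M n) (hn : 1 ≤ n) {P X Y : C}
    (hX : M X) [Projective P] (π : P ⟶ Y) [Epi π] :
    ∃ e : StableHom X Y ≃+ (covariantExtOn.{w} M n Y ⟶ covariantExtOn.{w} M n X),
      ∀ f : X ⟶ Y, e (QuotientAddGroup.mk f) = covariantExtOnMap.{w} M n f := by
  obtain ⟨D⟩ := hM.nonempty_syzygyClass π hn le_rfl
  refine ⟨AddEquiv.ofBijective (QuotientAddGroup.lift (projectiveHoms X Y)
    (AddMonoidHom.mk' _ covariantExtOnMap_add) fun f hf => covariantExtOnMap_eq_zero hn hf)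
    ⟨(injective_iff_map_eq_zero _).2 fun q hq => ?_, fun φ => ?_⟩, fun f => rfl⟩
  · obtain ⟨f, rfl⟩ := QuotientAddGroup.mk_surjective q
    exact (QuotientAddGroup.eq_zero_iff f).2
      (hM.mem_projectiveHoms_of_covariantExtOnMap_eq_zero hX D hq)
  · obtain ⟨f, hf⟩ := hM.exists_covariantExtOnMap_eq hX D φ
    exact ⟨QuotientAddGroup.mk f, hf⟩

theorem exists_costableHom_addEquiv (hM : IsClusterTilting.{w} M n) (hn : 1 ≤ n) {I X Y : C}
    (hY : M Y) [Injective I] (ι : X ⟶ I) [Mono ι] :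
    ∃ e : CostableHom X Y ≃+ (contravariantExtOn.{w} M n X ⟶ contravariantExtOn.{w} M n Y),
      ∀ f : X ⟶ Y, e (QuotientAddGroup.mk f) = contravariantExtOnMap.{w} M n f := by
  obtain ⟨D⟩ := hM.nonempty_cosyzygyClass ι hn le_rfl
  refine ⟨AddEquiv.ofBijective (QuotientAddGroup.lift (injectiveHoms X Y)
    (AddMonoidHom.mk' _ contravariantExtOnMap_add) fun f hf => contravariantExtOnMap_eq_zero hn hf)
    ⟨(injective_iff_map_eq_zero _).2 fun q hq => ?_, fun φ => ?_⟩, fun f => rfl⟩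
  · obtain ⟨f, rfl⟩ := QuotientAddGroup.mk_surjective q
    exact (QuotientAddGroup.eq_zero_iff f).2
      (hM.mem_injectiveHoms_of_contravariantExtOnMap_eq_zero hY D hq)
  · obtain ⟨f, hf⟩ := hM.exists_contravariantExtOnMap_eq hY D φ
    exact ⟨QuotientAddGroup.mk f, hf⟩

end IsClusterTilting

end HigherHiltonRees

/-! ### Length bounds for essential extensions. -/

section EssentialExtensions

/-- A submodule is essential if it meets every nonzero submodule nontrivially. -/
def Submodule.IsEssential {Λ U : Type*} [Ring Λ] [AddCommGroup U] [Module Λ U]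
    (S : Submodule Λ U) : Prop :=
  ∀ N : Submodule Λ U, N ⊓ S = ⊥ → N = ⊥

section Length

variable {R Λ U : Type*} [CommRing R] [Ring Λ] [Algebra R Λ] [AddCommGroup U] [Module Λ U]
  [Module R U] [IsScalarTower R Λ U]

/-- The preimage of `S` in the simple module `T` is zero or everything; if zero, the image of `h`
misses `S` and essentiality kills it. -/
lemma LinearMap.mem_of_isEssential {T : Type*} [AddCommGroup T] [Module Λ T] [IsSimpleModule Λ T]
    {S : Submodule Λ U} (hS : S.IsEssential) (h : T →ₗ[Λ] U) (t : T) : h t ∈ S := by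
  rcases eq_bot_or_eq_top (S.comap h) with hc | hc
  · have hr : LinearMap.range h = ⊥ := by
      refine hS _ ((Submodule.eq_bot_iff _).2 ?_)
      rintro _ ⟨⟨s, rfl⟩, hs⟩
      have : s ∈ S.comap h := hs
      rw [hc, Submodule.mem_bot] at this
      rw [this, map_zero]
    rw [LinearMap.range_eq_bot.1 hr]
    exact S.zero_mem
  · exact hc.ge (Submodule.mem_top : t ∈ ⊤)

/-- Evaluation at a nonzero `t` is injective, since `t` generates `T`, and it lands in `S`. -/
lemma Module.length_linearMap_le_of_isSimpleModule {T : Type*} [AddCommGroup T] [Module Λ T]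
    [IsSimpleModule Λ T] {S : Submodule Λ U} (hS : S.IsEssential) :
    Module.length R (T →ₗ[Λ] U) ≤ Module.length R S := by
  have := IsSimpleModule.nontrivial Λ T
  obtain ⟨t, ht⟩ := exists_ne (0 : T)
  let ev : (T →ₗ[Λ] U) →ₗ[R] S :=
    { toFun := fun h => ⟨h t, h.mem_of_isEssential hS t⟩
      map_add' := fun _ _ => rfl
      map_smul' := fun _ _ => rfl }
  refine Module.length_le_of_injective ev fun h h' hh => LinearMap.ext fun s => ?_
  obtain ⟨a, rfl⟩ := IsSimpleModule.toSpanSingleton_surjective Λ ht s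
  have : h t = h' t := congrArg Subtype.val hh
  simp [this]

variable (R) in
lemma Module.length_linearMap_le {A : Type*} [AddCommGroup A] [Module Λ A]
    (hA : IsFiniteLength Λ A) {S : Submodule Λ U} (hS : S.IsEssential) :
    Module.length R (A →ₗ[Λ] U) ≤ Module.length Λ A * Module.length R S := by
  induction hA with
  | of_subsingleton => simp [Module.length_eq_zero]
  | @of_simple_quotient A _ _ N _ _ ih =>
    let res : (A →ₗ[Λ] U) →ₗ[R] (N →ₗ[Λ] U) :=
      { toFun := fun h => h.comp N.subtype
        map_add' := fun _ _ => rfl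
        map_smul' := fun _ _ => rfl }
    let inf : (A ⧸ N →ₗ[Λ] U) →ₗ[R] (A →ₗ[Λ] U) :=
      { toFun := fun h => h.comp N.mkQ
        map_add' := fun _ _ => rfl
        map_smul' := fun _ _ => rfl }
    have hinf : Function.Injective inf := fun h h' hh => Submodule.linearMap_qext N hh
    -- Restriction to `N` need not be surjective; its range suffices for an upper bound.
    have hex : Function.Exact inf res.rangeRestrict := by
      intro h
      rw [← LinearMap.mem_ker, LinearMap.ker_rangeRestrict, LinearMap.mem_ker]
      constructor
      · intro hh
        refine ⟨N.liftQ h fun x hx => DFunLike.congr_fun hh (⟨x, hx⟩ : N), ?_⟩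
        exact N.liftQ_mkQ h _
      · rintro ⟨g, rfl⟩
        ext x
        change g (N.mkQ x) = 0
        rw [Submodule.mkQ_apply, (Submodule.Quotient.mk_eq_zero N).2 x.2, map_zero]
    rw [Module.length_eq_add_of_exact inf res.rangeRestrict hinf
        (LinearMap.surjective_rangeRestrict res) hex,
      Module.length_eq_add_of_exact N.subtype N.mkQ N.subtype_injective N.mkQ_surjective
        (LinearMap.exact_subtype_mkQ N), Module.length_eq_one Λ (A ⧸ N), add_mul, one_mul, add_comm]
    exact add_le_add ((Module.length_le_of_injective _ (Submodule.subtype_injective _)).trans ih)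
      (Module.length_linearMap_le_of_isSimpleModule hS)

variable (R) in
-- `Λ`-submodules are `R`-submodules, and `U` embeds `R`-linearly in `Λ →ₗ[Λ] U`, so the bound on
-- Hom applies with `A = Λ`.
lemma Module.length_le_of_isEssential (hΛ : IsFiniteLength Λ Λ) {S : Submodule Λ U}
    (hS : S.IsEssential) : Module.length Λ U ≤ Module.length Λ Λ * Module.length R S := by
  have hle : Module.length Λ U ≤ Module.length R U := by
    rw [← WithBot.coe_le_coe, Module.coe_length, Module.coe_length]
    exact Order.krullDim_le_of_orderEmbedding (Submodule.restrictScalarsEmbedding R Λ U)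
  refine hle.trans (le_trans ?_ (Module.length_linearMap_le R hΛ hS))
  let F : U →ₗ[R] (Λ →ₗ[Λ] U) :=
    { toFun := fun x => LinearMap.toSpanSingleton Λ U x
      map_add' := fun x y => by ext; simp
      map_smul' := fun r x => by ext; simp }
  refine Module.length_le_of_injective F fun x y hxy => ?_
  simpa [F] using DFunLike.congr_fun hxy (1 : Λ)

end Length

lemma Submodule.IsEssential.map_range {Λ X E V : Type*} [Ring Λ] [AddCommGroup X] [Module Λ X]
    [AddCommGroup E] [Module Λ E] [AddCommGroup V] [Module Λ V] {f : X →ₗ[Λ] E} {g : E →ₗ[Λ] V}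
    (hg : Function.Injective g) (hfe : (LinearMap.range f).IsEssential)
    (hge : (LinearMap.range g).IsEssential) : (LinearMap.range (g.comp f)).IsEssential := by
  intro N hN
  have hc : N.comap g = ⊥ := by
    refine hfe _ ((Submodule.eq_bot_iff _).2 ?_)
    rintro _ ⟨hx, x, rfl⟩
    have : g (f x) ∈ N ⊓ LinearMap.range (g.comp f) := ⟨hx, x, rfl⟩
    rw [hN, Submodule.mem_bot] at this
    exact hg (this.trans (map_zero g).symm)
  refine hge N ((Submodule.eq_bot_iff _).2 ?_)
  rintro _ ⟨hx, y, rfl⟩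
  have : y ∈ N.comap g := hx
  rw [hc, Submodule.mem_bot] at this
  rw [this, map_zero]

/-- `C` is maximal among submodules meeting the image of `g` trivially. If `N` misses the image of
`E` in `V ⧸ C`, its preimage still misses that of `E` in `V`, so it equals `C`. -/
lemma LinearMap.exists_essential_quotient {Λ E V : Type*} [Ring Λ] [AddCommGroup E] [Module Λ E]
    [AddCommGroup V] [Module Λ V] [IsNoetherian Λ V] (g : E →ₗ[Λ] V) (hg : Function.Injective g) :
    ∃ C : Submodule Λ V, Function.Injective (C.mkQ.comp g) ∧
      (LinearMap.range (C.mkQ.comp g)).IsEssential := by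
  obtain ⟨C, hC, hmax⟩ := set_has_maximal_iff_noetherian.2 (inferInstance : IsNoetherian Λ V)
    {C : Submodule Λ V | C ⊓ LinearMap.range g = ⊥} ⟨⊥, bot_inf_eq _⟩
  have hC' : ∀ y, g y ∈ C → g y = 0 := fun y hy => by
    have : g y ∈ C ⊓ LinearMap.range g := ⟨hy, y, rfl⟩
    rwa [hC, Submodule.mem_bot] at this
  refine ⟨C, (injective_iff_map_eq_zero _).2 fun y hy => ?_, fun N hN => ?_⟩
  · exact hg ((hC' y ((Submodule.Quotient.mk_eq_zero C).1 hy)).trans (map_zero g).symm)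
  · have hle : C ≤ N.comap C.mkQ := fun x hx => by
      rw [Submodule.mem_comap, Submodule.mkQ_apply, (Submodule.Quotient.mk_eq_zero C).2 hx]
      exact N.zero_mem
    have hcap : N.comap C.mkQ ⊓ LinearMap.range g = ⊥ := by
      refine (Submodule.eq_bot_iff _).2 ?_
      rintro _ ⟨hx, y, rfl⟩
      have : C.mkQ (g y) ∈ N ⊓ LinearMap.range (C.mkQ.comp g) := ⟨hx, y, rfl⟩
      rw [hN, Submodule.mem_bot] at this
      exact hC' y ((Submodule.Quotient.mk_eq_zero C).1 this)
    have heq : N.comap C.mkQ = C := by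
      by_contra hne
      exact hmax _ hcap (lt_of_le_of_ne hle (Ne.symm hne))
    rw [← Submodule.map_comap_eq_of_surjective C.mkQ_surjective N, heq, Submodule.mkQ_map_self]

end EssentialExtensions

/-! ### Enough injectives over an artin algebra. -/

section ArtinAlgebra

variable (Λ : Type u) [Ring Λ] [IsArtinAlgebra Λ]

instance IsArtinAlgebra.isArtinianRing : IsArtinianRing Λ := by
  obtain ⟨R, _, _, _, _⟩ := IsArtinAlgebra.exists_base (Λ := Λ)
  exact isArtinian_of_tower R inferInstance

lemma IsArtinAlgebra.exists_length_bound (X : Type u) [AddCommGroup X] [Module Λ X]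
    [Module.Finite Λ X] : ∃ B : ℕ, ∀ (U : Type u) [AddCommGroup U] [Module Λ U] (f : X →ₗ[Λ] U),
      (LinearMap.range f).IsEssential → Module.length Λ U ≤ B := by
  have hΛ : IsFiniteLength Λ Λ :=
    isFiniteLength_iff_isNoetherian_isArtinian.2 ⟨inferInstance, inferInstance⟩
  obtain ⟨R, _, _, _, _⟩ := IsArtinAlgebra.exists_base (Λ := Λ)
  let := Module.compHom X (algebraMap R Λ)
  have : IsScalarTower R Λ X := IsScalarTower.of_compHom R Λ X
  have : Module.Finite R X := Module.Finite.trans Λ X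
  have hX : Module.length R X ≠ ⊤ := Module.length_ne_top
  have hne : Module.length Λ Λ * Module.length R X ≠ ⊤ :=
    WithTop.mul_ne_top (Module.length_ne_top_iff.2 hΛ) hX
  refine ⟨(Module.length Λ Λ * Module.length R X).toNat, fun U _ _ f hf => ?_⟩
  let := Module.compHom U (algebraMap R Λ)
  have : IsScalarTower R Λ U := IsScalarTower.of_compHom R Λ U
  rw [ENat.natCast_toNat hne]
  refine (Module.length_le_of_isEssential R hΛ hf).trans ?_
  gcongr
  exact Module.length_le_of_surjective (f.rangeRestrict.restrictScalars R)
    f.surjective_rangeRestrict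

/-- `E` is an essential extension of `X` of maximal length. An embedding of `E` in `V` becomes
essential in some `V ⧸ C`, where maximality forces an isomorphism; its inverse gives the retraction.
-/
lemma IsArtinAlgebra.exists_split_extension (X : Type u) [AddCommGroup X] [Module Λ X]
    [Module.Finite Λ X] : ∃ (E : Type u) (_ : AddCommGroup E) (_ : Module Λ E)
      (_ : Module.Finite Λ E) (f : X →ₗ[Λ] E), Function.Injective f ∧
      ∀ (V : Type u) [AddCommGroup V] [Module Λ V] [Module.Finite Λ V] (g : E →ₗ[Λ] V),
        Function.Injective g → ∃ r : V →ₗ[Λ] E, r.comp g = LinearMap.id := by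
  obtain ⟨B, hB⟩ := IsArtinAlgebra.exists_length_bound Λ X
  let s : Set ℕ := {k | ∃ (E : Type u) (_ : AddCommGroup E) (_ : Module Λ E) (f : X →ₗ[Λ] E),
    Function.Injective f ∧ (LinearMap.range f).IsEssential ∧ Module.length Λ E = k}
  have hs : BddAbove s := by
    refine ⟨B, ?_⟩
    rintro k ⟨E, _, _, f, -, hf, hk⟩
    exact_mod_cast hk ▸ hB E f hf
  have hne : s.Nonempty := by
    refine ⟨(Module.length Λ X).toNat, X, _, _, LinearMap.id, Function.injective_id, ?_,
      (ENat.natCast_toNat Module.length_ne_top).symm⟩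
    intro N hN
    rwa [LinearMap.range_id, inf_top_eq] at hN
  obtain ⟨E, _, _, f, hf, hfe, hE⟩ := Nat.sSup_mem hne hs
  have hfin : IsFiniteLength Λ E := Module.length_ne_top_iff.1 (hE ▸ ENat.natCast_ne_top _)
  obtain ⟨_, _⟩ := isFiniteLength_iff_isNoetherian_isArtinian.1 hfin
  refine ⟨E, _, _, inferInstance, f, hf, fun V _ _ _ g hg => ?_⟩
  obtain ⟨C, hi, he⟩ := g.exists_essential_quotient hg
  have hle : Module.length Λ (V ⧸ C) ≤ Module.length Λ E := by
    have hmem : (Module.length Λ (V ⧸ C)).toNat ∈ s :=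
      ⟨V ⧸ C, _, _, (C.mkQ.comp g).comp f, hi.comp hf, hfe.map_range hi he,
        (ENat.natCast_toNat Module.length_ne_top).symm⟩
    rw [hE, ← ENat.natCast_toNat (Module.length_ne_top (R := Λ) (M := V ⧸ C))]
    exact_mod_cast le_csSup hs hmem
  have hsurj : Function.Surjective (C.mkQ.comp g) := by
    rw [← LinearMap.range_eq_top]
    by_contra hr
    refine (Submodule.length_lt hr).not_ge (hle.trans ?_)
    exact (LinearEquiv.ofInjective _ hi).length_eq.le
  let e := LinearEquiv.ofBijective (C.mkQ.comp g) ⟨hi, hsurj⟩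
  refine ⟨e.symm.toLinearMap.comp C.mkQ, LinearMap.ext fun x => ?_⟩
  exact e.symm_apply_apply x

/-- The category of finitely generated modules over an artin algebra has enough injectives. -/
instance FGModuleCat.enoughInjectives_of_isArtinAlgebra : EnoughInjectives (FGModuleCat.{u} Λ) where
  presentation X := by
    obtain ⟨E, _, _, _, f, hf, hE⟩ := IsArtinAlgebra.exists_split_extension Λ X
    let ι : X ⟶ FGModuleCat.of Λ E := ObjectProperty.homMk (ModuleCat.ofHom f)
    have hι : Mono ((forget₂ (FGModuleCat.{u} Λ) (ModuleCat.{u} Λ)).map ι) :=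
      (ModuleCat.mono_iff_injective _).2 hf
    have : Mono ι := Functor.mono_of_mono_map _ hι
    have hinj : Injective (FGModuleCat.of Λ E) := by
      -- To extend `g` along the mono `i`, form their pushout: the leg from `E` is mono, hence
      -- splits, and the retraction composed with the other leg extends `g`.
      refine ⟨fun {A B} g i _ => ?_⟩
      have hm : Mono ((forget₂ (FGModuleCat.{u} Λ) (ModuleCat.{u} Λ)).map (pushout.inl g i)) :=
        inferInstance
      obtain ⟨r, hr⟩ := hE _ (pushout.inl g i).hom.hom ((ModuleCat.mono_iff_injective _).1 hm)
      let ρ : pushout g i ⟶ FGModuleCat.of Λ E := ObjectProperty.homMk (ModuleCat.ofHom r)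
      have hρ : pushout.inl g i ≫ ρ = 𝟙 _ := FGModuleCat.hom_ext hr
      exact ⟨pushout.inr g i ≫ ρ, by rw [← pushout.condition_assoc, hρ, Category.comp_id]⟩
    exact ⟨⟨_, hinj, ι, this⟩⟩

end ArtinAlgebra

theorem mainTheorem5 (Λ : Type u) [Ring Λ] [IsArtinAlgebra Λ] (n : ℕ) (hn : 1 ≤ n)
    (M : ObjectProperty (FGModuleCat.{u} Λ)) (hM : IsClusterTilting.{u} M n)
    (X Y : FGModuleCat.{u} Λ) (hX : M X) (hY : M Y) :
    (∃ e : StableHom X Y ≃+ (covariantExtOn.{u} M n Y ⟶ covariantExtOn.{u} M n X),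
      ∀ f : X ⟶ Y, e (QuotientAddGroup.mk f) = covariantExtOnMap.{u} M n f) ∧
    (∃ e : CostableHom X Y ≃+ (contravariantExtOn.{u} M n X ⟶ contravariantExtOn.{u} M n Y),
      ∀ f : X ⟶ Y, e (QuotientAddGroup.mk f) = contravariantExtOnMap.{u} M n f) :=
  ⟨hM.exists_stableHom_addEquiv hn hX (Projective.π Y),
    hM.exists_costableHom_addEquiv hn hY (Injective.ι X)⟩
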